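/- Let $\mathbb U$ be Urysohn's universal metric space, i.e. (up to isometry) the only complete separable metric space such that every complete separable metric space is isometric to a subset of $\mathbb U$, and every isometry between two finite subsets of $\mathbb U$ extends to an isometry of $\mathbb U$ onto itself. All Banach spaces are real. For a metric space $(X,d)$ and $p,q\in X$ let $m_{pq}=\chi_{\{p\}}-\chi_{\{q\}}$. The Lipschitz-free space $F(X)$ is the completion of the space of molecules, i.e. of finitely supported functions $m\colon X\to\mathbb R$ with $\sum_{x\in X} m(x)=0$, for the norm $$\|m\|=\inf\Big\{\sum_{i=1}^n |a_i|\,d(p_i,q_i)\colon m=\sum_{i=1}^n a_i m_{p_iq_i},\ a_i\in\mathbb R,\ p_i,q_i\in X\Big\}.$$ 1. For every $e\in\mathbb U$, the map $x\mapsto m_{xe}$ is an isometric embedding of $\mathbb U$ into $F(\mathbb U)$ which sends $e$ to $0$ and whose image has closed linear span $F(\mathbb U)$. 2. Let $B$ be a Banach space, and let $i\colon\mathbb U\to B$ be an isometric embedding with $i(e)=0$ for some $e\in\mathbb U$. Then there is a surjective linear isometry $T$ from $F(\mathbb U)$ onto the closed linear span of $i(\mathbb U)$ in $B$, with $T(m_{xe})=i(x)$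 for all $x\in\mathbb U$. Thus the closed linear span of $\mathbb U$ is uniquely determined up to linear isometry. 3. This space is universal for separable Banach spaces up to linear isometry: $F(\mathbb U)$, and likewise the closed linear span of $i(\mathbb U)$ for every $B$ and $i$ as in 2, is a separable Banach space, and every separable Banach space admits a linear isometric embedding into it. -/

import Mathlib

open Set

/-- Urysohn's universal metric space, by its characterization up to isometry: a Polish metric space
(complete and separable) that is universal for Polish metric spaces and `ω`-homogeneous.
Every Polish metric space has an isometric copy in `Type`, so letting `P` range over `Type` is no
restriction, whatever the universe of `U`. -/
structure IsUrysohn (U : Type*) [MetricSpace U] : Prop where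
  complete : CompleteSpace U
  separable : TopologicalSpace.SeparableSpace U
  universal : ∀ (P : Type) [MetricSpace P] [CompleteSpace P] [TopologicalSpace.SeparableSpace P],
    ∃ f : P → U, Isometry f
  homogeneous : ∀ (F₁ F₂ : Set U), F₁.Finite → F₂.Finite → ∀ φ : F₁ ≃ᵢ F₂,
    ∃ ψ : U ≃ᵢ U, ∀ x : F₁, ψ (x : U) = (φ x : U)

/-- Finitely supported functions `m : X → ℝ` with `∑ x, m x = 0`, as a subspace. -/
def moleculeSubmodule (X : Type*) : Submodule ℝ (X →₀ ℝ) where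
  carrier := {m | m.sum (fun _ r => r) = 0}
  zero_mem' := Finsupp.sum_zero_index
  add_mem' := by
    intro a b ha hb
    simp only [mem_ofPred_eq] at *
    rw [Finsupp.sum_add_index' (fun _ => rfl) (fun _ _ _ => rfl), ha, hb, add_zero]
  smul_mem' := by
    intro c m hm
    simp only [mem_ofPred_eq] at *
    rw [Finsupp.sum_smul_index (fun _ => rfl), ← Finsupp.mul_sum, hm, mul_zero]

/-- The space of molecules on `X`. -/
def Molecule (X : Type*) : Type _ := moleculeSubmodule X

namespace Molecule

noncomputable instance (X : Type*) : AddCommGroup (Molecule X) :=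
  inferInstanceAs (AddCommGroup (moleculeSubmodule X))

noncomputable instance (X : Type*) : Module ℝ (Molecule X) :=
  inferInstanceAs (Module ℝ (moleculeSubmodule X))

/-- The elementary molecule `m_{pq} = χ_{p} - χ_{q}`. -/
noncomputable def pair {X : Type*} (p q : X) : Molecule X :=
  ⟨Finsupp.single p 1 - Finsupp.single q 1, by
    change (Finsupp.single p (1 : ℝ) - Finsupp.single q 1).sum (fun _ r => r) = 0
    rw [Finsupp.sum_sub_index (fun _ _ _ => rfl), Finsupp.sum_single_index rfl,
      Finsupp.sum_single_index rfl, sub_self]⟩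

/-- The costs `∑ i, |a i| * d (p i, q i)` of all representations `m = ∑ i, a i • m_{p i, q i}`. -/
def costs {X : Type*} [MetricSpace X] (m : Molecule X) : Set ℝ :=
  {r | ∃ (n : ℕ) (a : Fin n → ℝ) (p q : Fin n → X),
    m = ∑ i, a i • pair (p i) (q i) ∧ r = ∑ i, |a i| * dist (p i) (q i)}

/-- The norm of a molecule: the infimum of the costs of its representations. -/
noncomputable instance (X : Type*) [MetricSpace X] : Norm (Molecule X) :=
  ⟨fun m => sInf (costs m)⟩

theorem norm_def {X : Type*} [MetricSpace X] (m : Molecule X) : ‖m‖ = sInf (costs m) := rfl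

theorem costs_nonneg {X : Type*} [MetricSpace X] {m : Molecule X} {r : ℝ} (h : r ∈ costs m) :
    0 ≤ r := by
  obtain ⟨n, a, p, q, -, rfl⟩ := h
  exact Finset.sum_nonneg fun i _ => mul_nonneg (abs_nonneg _) dist_nonneg

theorem costs_bddBelow {X : Type*} [MetricSpace X] (m : Molecule X) : BddBelow (costs m) :=
  ⟨0, fun _ h => costs_nonneg h⟩

theorem costs_add {X : Type*} [MetricSpace X] {m m' : Molecule X} {r r' : ℝ}
    (h : r ∈ costs m) (h' : r' ∈ costs m') : r + r' ∈ costs (m + m') := by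
  obtain ⟨n, a, p, q, rfl, rfl⟩ := h
  obtain ⟨n', a', p', q', rfl, rfl⟩ := h'
  refine ⟨n + n', Fin.append a a', Fin.append p p', Fin.append q q', ?_, ?_⟩ <;>
    simp [Fin.sum_univ_add]

theorem costs_smul {X : Type*} [MetricSpace X] (c : ℝ) {m : Molecule X} {r : ℝ}
    (h : r ∈ costs m) : |c| * r ∈ costs (c • m) := by
  obtain ⟨n, a, p, q, rfl, rfl⟩ := h
  refine ⟨n, fun i => c * a i, p, q, ?_, ?_⟩
  · simp [Finset.smul_sum, mul_smul]
  · simp [Finset.mul_sum, abs_mul, mul_assoc]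

/-- Every molecule is a linear combination of elementary ones. -/
theorem costs_nonempty {X : Type*} [MetricSpace X] (m : Molecule X) : (costs m).Nonempty := by
  rcases isEmpty_or_nonempty X with hX | ⟨⟨e⟩⟩
  · refine ⟨0, 0, Fin.elim0, Fin.elim0, Fin.elim0, ?_, by simp⟩
    exact Subtype.ext (Subsingleton.elim _ _)
  · have key : m = ∑ x ∈ m.1.support, m.1 x • pair x e := by
      have hm : ∑ x ∈ m.1.support, m.1 x = 0 := m.2
      apply Subtype.ext
      have h1 : (∑ x ∈ m.1.support, m.1 x • pair x e : Molecule X).1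
          = ∑ x ∈ m.1.support, m.1 x • (Finsupp.single x (1 : ℝ) - Finsupp.single e 1) :=
        map_sum (moleculeSubmodule X).subtype (fun x => m.1 x • pair x e) _
      rw [h1]
      simp only [smul_sub, Finset.sum_sub_distrib]
      rw [← Finset.sum_smul, hm, zero_smul, sub_zero]
      simp only [Finsupp.smul_single, smul_eq_mul, mul_one]
      exact (Finsupp.sum_single m.1).symm
    have hs : ∀ s : Finset X, (costs (∑ x ∈ s, m.1 x • pair x e)).Nonempty := by
      intro s
      classical
      induction s using Finset.induction_on with
      | empty => exact ⟨0, 0, Fin.elim0, Fin.elim0, Fin.elim0, by simp, by simp⟩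
      | insert x s hx ih =>
        obtain ⟨r, hr⟩ := ih
        rw [Finset.sum_insert hx]
        exact ⟨_, costs_add (r := |m.1 x| * dist x e)
          ⟨1, fun _ => m.1 x, fun _ => x, fun _ => e, by simp, by simp⟩ hr⟩
    rw [key]
    exact hs _

theorem norm_smul_le_aux {X : Type*} [MetricSpace X] (c : ℝ) (m : Molecule X) :
    ‖c • m‖ ≤ |c| * ‖m‖ := by
  rw [norm_def m, ← smul_eq_mul, ← Real.sInf_smul_of_nonneg (abs_nonneg c)]
  refine le_csInf ((costs_nonempty m).smul_set) ?_
  rintro _ ⟨r, hr, rfl⟩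
  exact csInf_le (costs_bddBelow _) (costs_smul c hr)

theorem seminormCore (X : Type*) [MetricSpace X] : SeminormedSpace.Core ℝ (Molecule X) where
  norm_nonneg m := Real.sInf_nonneg fun _ h => costs_nonneg h
  norm_smul c m := by
    rw [Real.norm_eq_abs]
    refine le_antisymm (norm_smul_le_aux c m) ?_
    rcases eq_or_ne c 0 with rfl | hc
    · rw [abs_zero, zero_mul]
      exact Real.sInf_nonneg fun _ h => costs_nonneg h
    · have h := norm_smul_le_aux c⁻¹ (c • m)
      rw [inv_smul_smul₀ hc, abs_inv] at h
      rwa [← le_inv_mul_iff₀ (abs_pos.2 hc)]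
  norm_triangle m m' := by
    rw [norm_def m, norm_def m', ← csInf_add (costs_nonempty m) (costs_bddBelow m)
      (costs_nonempty m') (costs_bddBelow m')]
    refine le_csInf ((costs_nonempty m).add (costs_nonempty m')) ?_
    rintro _ ⟨r, hr, r', hr', rfl⟩
    exact csInf_le (costs_bddBelow _) (costs_add hr hr')

noncomputable instance (X : Type*) [MetricSpace X] : SeminormedAddCommGroup (Molecule X) :=
  SeminormedAddCommGroup.ofCore (seminormCore X)

noncomputable instance (X : Type*) [MetricSpace X] : NormedSpace ℝ (Molecule X) where
  norm_smul_le c m := norm_smul_le_aux c m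

end Molecule

/-- The Lipschitz-free (Arens-Eells) space `F(X)`: the (Hausdorff) completion of the space of
molecules, a real Banach space. -/
abbrev LipschitzFree (X : Type*) [MetricSpace X] : Type _ :=
  UniformSpace.Completion (Molecule X)

/-- The canonical map `x ↦ m_{xe}` of `X` into `F(X)`, for a base point `e`. -/
noncomputable def LipschitzFree.delta {X : Type*} [MetricSpace X] (e x : X) : LipschitzFree X :=
  ((Molecule.pair x e : Molecule X) : UniformSpace.Completion (Molecule X))

/-- The closed linear span, in a normed space `B`, of the image of `i : X → B`. -/
abbrev closedSpan {X B : Type*} [NormedAddCommGroup B] [NormedSpace ℝ B] (i : X → B) :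
    Submodule ℝ B :=
  (Submodule.span ℝ (range i)).topologicalClosure

/-- `V` is universal for separable Banach spaces up to linear isometry: `V` is itself a separable
Banach space, and every separable real Banach space embeds linearly and isometrically in `V`. -/
def IsUniversalSeparableBanach.{w, v} (V : Type v) [NormedAddCommGroup V] [NormedSpace ℝ V] :
    Prop :=
  CompleteSpace V ∧ TopologicalSpace.SeparableSpace V ∧
    ∀ (E : Type w) [NormedAddCommGroup E] [NormedSpace ℝ E] [CompleteSpace E]
      [TopologicalSpace.SeparableSpace E], Nonempty (E →ₗᵢ[ℝ] V)

universe u v w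

/-!
The space `F(X)` linearizes `1`-Lipschitz maps: `f : X → B` induces a linear map `F(X) → B` of norm
at most `1` with `m_{xe} ↦ f x - f e` (`LipschitzFree.lift`, `LipschitzFree.lift_delta`). Testing on
distance functions shows that `x ↦ m_{xe}` is isometric.

**Uniqueness of the span.** Let `i : U → B` be isometric and let `m` be a molecule. By Hahn-Banach
some `1`-Lipschitz `f : U → ℝ` satisfies `∑ m x * f x = ‖m‖`. Since `U` realizes every finite metric
extension of its finite subsets, it contains points `u` and `v` with `dist u x = M - f x`,
`dist x v = M + f x` on the support of `m`, and `dist u v = 2 * M` (`IsUrysohn.exists_between`). A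
functional of norm at most `1` that norms `i u - i v` is then forced to be `f + const` on the image
of the support. Hence `‖∑ m x • i x‖ ≥ ‖m‖` (`IsUrysohn.norm_lift_molecule`), and the linearization
of `i` is isometric.

**Universality.** A separable Banach space `E` has an isometric copy in `U`, so it has a (nonlinear)
isometric embedding `j` in `F(U)`. A functional of norm at most `1` on `E` is a `1`-Lipschitz
function on this copy; it extends to a `1`-Lipschitz function on `U`, hence comes from a functional
of norm at most `1` on `F(U)`. This property of `j` survives averaging of translates. Averaging over
the segments spanned by a summable sequence of vectors with dense directions yields a `1`-Lipschitz
`ψ : E → F(U)` that is smooth in a dense set of directions (`exists_smoothing`). Its derivative at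
`0` is linear of norm at most `1` (`exists_tendsto_dyadicQuotient`) and does not shrink norms, by the
pulled back functionals (`nonempty_linearIsometry_of_lipschitzWith`).
-/

/-! ### Linearization of maps on molecules -/

namespace Molecule

variable {X B : Type*}

/-- The linear map `m ↦ ∑ x, m x • f x` on molecules, for a map `f` into a vector space. -/
noncomputable def lift [AddCommGroup B] [Module ℝ B] (f : X → B) : Molecule X →ₗ[ℝ] B :=
  (Finsupp.linearCombination ℝ f).comp (moleculeSubmodule X).subtype

theorem lift_apply [AddCommGroup B] [Module ℝ B] (f : X → B) (m : Molecule X) :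
    lift f m = ∑ x ∈ m.1.support, m.1 x • f x := rfl

@[simp]
theorem lift_pair [AddCommGroup B] [Module ℝ B] (f : X → B) (p q : X) :
    lift f (pair p q) = f p - f q := by
  change Finsupp.linearCombination ℝ f (Finsupp.single p 1 - Finsupp.single q 1) = _
  simp

/-- Since the coefficients of a molecule add up to `0`, additive constants do not matter. -/
theorem lift_eq_of_eqOn_add_const [AddCommGroup B] [Module ℝ B] {f g : X → B} (c : B)
    {m : Molecule X} (h : ∀ x ∈ m.1.support, f x = g x + c) : lift f m = lift g m := by
  have hm : ∑ x ∈ m.1.support, m.1 x = 0 := m.2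
  have key : ∑ x ∈ m.1.support, m.1 x • f x = ∑ x ∈ m.1.support, (m.1 x • g x + m.1 x • c) :=
    Finset.sum_congr rfl fun x hx => by rw [h x hx, smul_add]
  rw [lift_apply, lift_apply, key, Finset.sum_add_distrib, ← Finset.sum_smul, hm, zero_smul,
    add_zero]

theorem pair_eq_sub (e p q : X) : pair p q = pair p e - pair q e :=
  Subtype.ext (sub_sub_sub_cancel_right _ _ _).symm

variable [MetricSpace X]

theorem linearMap_ext [AddCommGroup B] [Module ℝ B] {L L' : Molecule X →ₗ[ℝ] B}
    (h : ∀ p q, L (pair p q) = L' (pair p q)) : L = L' := by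
  ext m
  obtain ⟨_, n, a, p, q, rfl, -⟩ := costs_nonempty m
  simp only [map_sum, map_smul, h]

theorem norm_pair_le (p q : X) : ‖pair p q‖ ≤ dist p q :=
  csInf_le (costs_bddBelow _) ⟨1, fun _ => 1, fun _ => p, fun _ => q, by simp, by simp⟩

theorem norm_lift_le [SeminormedAddCommGroup B] [NormedSpace ℝ B] {f : X → B}
    (hf : LipschitzWith 1 f) (m : Molecule X) : ‖lift f m‖ ≤ 1 * ‖m‖ := by
  rw [one_mul, norm_def]
  refine le_csInf (costs_nonempty m) ?_
  rintro _ ⟨n, a, p, q, rfl, rfl⟩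
  rw [map_sum]
  refine (norm_sum_le _ _).trans (Finset.sum_le_sum fun i _ => ?_)
  rw [map_smul, lift_pair, norm_smul, Real.norm_eq_abs, ← dist_eq_norm]
  gcongr
  simpa using hf.dist_le_mul (p i) (q i)

end Molecule

/-! ### Linearization of maps on the Lipschitz-free space -/

namespace LipschitzFree

open Molecule UniformSpace

variable {X B : Type*} [MetricSpace X] [NormedAddCommGroup B] [NormedSpace ℝ B]

/-- The canonical map from molecules to the Lipschitz-free space. -/
noncomputable abbrev ofMolecule : Molecule X →L[ℝ] LipschitzFree X := Completion.toComplL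

theorem denseRange_ofMolecule : DenseRange (ofMolecule (X := X)) :=
  Completion.denseRange_coe

theorem delta_self (e : X) : delta e e = 0 := by
  have h : pair e e = 0 := by simpa using pair_eq_sub e e e
  rw [delta, h, Completion.coe_zero]

theorem delta_sub (e p q : X) : delta e p - delta e q = (pair p q : Molecule X) := by
  rw [delta, delta, ← Completion.coe_sub, ← pair_eq_sub]

theorem lipschitzWith_delta (e : X) : LipschitzWith 1 (delta e) :=
  LipschitzWith.of_dist_le_mul fun p q => by
    rw [dist_eq_norm, delta_sub, Completion.norm_coe]
    simpa using norm_pair_le p q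

/-- A bounded linear map on `F(X)` is given on molecules by its values at the points of `X`. -/
theorem apply_coe (φ : LipschitzFree X →L[ℝ] B) (e : X) (m : Molecule X) :
    φ (m : LipschitzFree X) = Molecule.lift (fun x => φ (delta e x)) m := by
  have h : φ.toLinearMap.comp (ofMolecule (X := X)).toLinearMap =
      Molecule.lift fun x => φ (delta e x) := linearMap_ext fun p q => by
    rw [lift_pair, ← map_sub, delta_sub]
    rfl
  exact LinearMap.congr_fun h m

variable [CompleteSpace B]

/-- The linearization of a `1`-Lipschitz map `f : X → B`: the continuous linear map of `F(X)` into
`B` that sends `m_{xe}` to `f x - f e`. (For `f` that is not Lipschitz the value is junk.) -/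
noncomputable def lift (f : X → B) : LipschitzFree X →L[ℝ] B :=
  (Molecule.lift f).extendOfNorm (ofMolecule (X := X)).toLinearMap

theorem lift_coe {f : X → B} (hf : LipschitzWith 1 f) (m : Molecule X) :
    lift f (m : LipschitzFree X) = Molecule.lift f m :=
  LinearMap.extendOfNorm_eq (e := (ofMolecule (X := X)).toLinearMap) denseRange_ofMolecule
    ⟨1, fun x => by simpa using norm_lift_le hf x⟩ m

theorem norm_lift_le {f : X → B} (hf : LipschitzWith 1 f) : ‖lift f‖ ≤ 1 :=
  LinearMap.opNorm_extendOfNorm_le denseRange_ofMolecule zero_le_one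
    fun x => by simpa using Molecule.norm_lift_le hf x

theorem lift_delta {f : X → B} (hf : LipschitzWith 1 f) (e x : X) :
    lift f (delta e x) = f x - f e := by
  rw [delta, lift_coe hf, lift_pair]

/-- The lower bound is tested on the linearization of the `1`-Lipschitz function `dist · q`. -/
theorem isometry_delta (e : X) : Isometry (delta e) := by
  refine Isometry.of_dist_eq fun p q =>
    le_antisymm (by simpa using (lipschitzWith_delta e).dist_le_mul p q) ?_
  have hf : LipschitzWith 1 fun x => dist x q := LipschitzWith.dist_left q
  calc dist p q = lift (fun x => dist x q) (delta e p - delta e q) := by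
        rw [map_sub, lift_delta hf, lift_delta hf]; simp
    _ ≤ ‖lift (fun x => dist x q) (delta e p - delta e q)‖ := Real.le_norm_self _
    _ ≤ 1 * ‖delta e p - delta e q‖ := (lift _).le_of_opNorm_le (norm_lift_le hf) _
    _ = dist (delta e p) (delta e q) := by rw [one_mul, dist_eq_norm]

theorem closedSpan_delta (e : X) : closedSpan (delta e) = ⊤ := by
  rw [closedSpan, ← Submodule.dense_iff_topologicalClosure_eq_top]
  refine denseRange_ofMolecule.mono ?_
  rintro _ ⟨m, rfl⟩
  obtain ⟨_, n, a, p, q, rfl, -⟩ := costs_nonempty m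
  rw [map_sum]
  refine Submodule.sum_mem _ fun i _ => ?_
  rw [map_smul]
  refine Submodule.smul_mem _ _ ?_
  have h : ofMolecule (pair (p i) (q i)) = delta e (p i) - delta e (q i) := (delta_sub _ _ _).symm
  rw [h]
  exact Submodule.sub_mem _ (Submodule.subset_span ⟨_, rfl⟩) (Submodule.subset_span ⟨_, rfl⟩)

theorem separableSpace [TopologicalSpace.SeparableSpace X] (e : X) :
    TopologicalSpace.SeparableSpace (LipschitzFree X) := by
  have h := ((TopologicalSpace.isSeparable_range (isometry_delta e).continuous).span
    (R := ℝ)).closure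
  have h' : closure (Submodule.span ℝ (range (delta e)) : Set (LipschitzFree X)) = univ := by
    rw [← Submodule.topologicalClosure_coe, ← closedSpan, closedSpan_delta, Submodule.top_coe]
  rw [h'] at h
  exact TopologicalSpace.isSeparable_univ_iff.1 h

end LipschitzFree

/-! ### Linear rigidity of Urysohn's space -/

namespace IsUrysohn

variable {U : Type*} [MetricSpace U]

/-- The extension property of Urysohn's space: a finite metric space that contains an isometric
copy of a finite subset `S` of `U` embeds in `U` over `S`. -/
theorem exists_isometry_extending (hU : IsUrysohn U) {S : Set U} (hS : S.Finite) (P : Type)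
    [MetricSpace P] [Finite P] {j : S → P} (hj : Isometry j) :
    ∃ k : P → U, Isometry k ∧ ∀ x : S, k (j x) = x := by
  obtain ⟨k₀, hk₀⟩ := hU.universal P
  have := hS.to_subtype
  obtain ⟨ψ, hψ⟩ := hU.homogeneous (range (k₀ ∘ j)) S (finite_range _) hS
    (hk₀.comp hj).isometryEquivOnRange.symm
  refine ⟨ψ ∘ k₀, ψ.isometry.comp hk₀, fun x => ?_⟩
  have h := hψ ((hk₀.comp hj).isometryEquivOnRange x)
  rwa [IsometryEquiv.symm_apply_apply] at h

/-- Any finite set `S` in Urysohn's space lies metrically between two far away points `u` and `v`,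
in such a way that a prescribed `1`-Lipschitz function agrees on `S`, up to constants, with
`-dist u ·` and with `dist · v`. -/
theorem exists_between (hU : IsUrysohn U) {f : U → ℝ} (hf : LipschitzWith 1 f) {S : Set U}
    (hS : S.Finite) :
    ∃ (u v : U) (M : ℝ), dist u v = 2 * M ∧
      ∀ x ∈ S, dist u x = M - f x ∧ dist x v = M + f x := by
  have := hU.separable
  obtain ⟨k, -⟩ := hU.universal Unit
  set e : U := k ()
  have hK := kuratowskiEmbedding.isometry U
  set K := kuratowskiEmbedding U
  obtain ⟨M₀, hM₀⟩ := (hS.image fun x => |f x| + dist x e).bddAbove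
  -- `M` is so large that the vertical distances below dominate the horizontal ones.
  set M := max M₀ 0
  have hM : ∀ x ∈ S, |f x| + dist x e ≤ M := fun x hx =>
    (hM₀ (mem_image_of_mem _ hx)).trans (le_max_left _ _)
  have hM0 : 0 ≤ M := le_max_right _ _
  -- The graph of `f` on `S`, with two points far up and far down, in `ℓ^∞(ℕ) × ℝ` with the
  -- maximum metric.
  set g := fun x : U => (K x, f x)
  set Q := insert (K e, M) (insert (K e, -M) (g '' S)) with hQ
  have : Finite Q := (((hS.image g).insert _).insert _).to_subtype
  have hg : Isometry fun x : S => (⟨g x, by simp [hQ, mem_image_of_mem g x.2]⟩ : Q) := by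
    refine Isometry.of_dist_eq fun x y => ?_
    rw [Subtype.dist_eq, Prod.dist_eq, hK.dist_eq, Subtype.dist_eq]
    exact max_eq_left (by simpa using hf.dist_le_mul x y)
  obtain ⟨k, hk, hkS⟩ := hU.exists_isometry_extending hS Q hg
  refine ⟨k ⟨(K e, M), by simp [hQ]⟩, k ⟨(K e, -M), by simp [hQ]⟩, M, ?_, fun x hx => ?_⟩
  · rw [hk.dist_eq, Subtype.dist_eq, Prod.dist_eq, dist_self, Real.dist_eq, sub_neg_eq_add,
      ← two_mul, abs_of_nonneg (by positivity), max_eq_right (by positivity)]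
  · have h := hM x hx
    have h₁ := abs_le.1 (le_refl |f x|)
    have h₂ := dist_nonneg (x := x) (y := e)
    have hx' := hkS ⟨x, hx⟩
    simp only at hx'
    constructor
    · rw [show dist (k ⟨(K e, M), by simp [hQ]⟩) x = dist _ (k ⟨g x, _⟩) by rw [hx'],
        hk.dist_eq, Subtype.dist_eq, Prod.dist_eq, hK.dist_eq, dist_comm, Real.dist_eq,
        abs_of_nonneg (by linarith), max_eq_right (by linarith)]
    · rw [show dist x (k ⟨(K e, -M), by simp [hQ]⟩) = dist (k ⟨g x, _⟩) _ by rw [hx'],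
        hk.dist_eq, Subtype.dist_eq, Prod.dist_eq, hK.dist_eq, Real.dist_eq,
        abs_of_nonneg (by linarith), max_eq_right (by linarith)]
      ring

variable {B : Type*} [NormedAddCommGroup B] [NormedSpace ℝ B]

/-- On molecules, the linearization of an isometric embedding of Urysohn's space preserves the
norm: a functional that norms `i u - i v`, for `u` and `v` far away on both sides of the support of
`m`, has to take prescribed values there. -/
theorem norm_lift_molecule (hU : IsUrysohn U) {i : U → B} (hi : Isometry i) (m : Molecule U) :
    ‖Molecule.lift i m‖ = ‖m‖ := by
  refine le_antisymm (by simpa using Molecule.norm_lift_le hi.lipschitz m) ?_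
  obtain ⟨k, -⟩ := hU.universal Unit
  set e : U := k ()
  obtain ⟨φ, hφ, hφm⟩ := exists_dual_vector'' ℝ (m : LipschitzFree U)
  set f : U → ℝ := fun x => φ (LipschitzFree.delta e x)
  have hf : LipschitzWith 1 f := by
    have h := φ.lipschitz.comp (LipschitzFree.lipschitzWith_delta e)
    exact h.weaken (by rw [mul_one]; exact hφ)
  obtain ⟨u, v, M, huv, hS⟩ := hU.exists_between hf m.1.support.finite_toSet
  obtain ⟨g, hg, hguv⟩ := exists_dual_vector'' ℝ (i u - i v)
  rw [← dist_eq_norm, hi.dist_eq, huv] at hguv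
  have hg' : ∀ x y, g (i x) - g (i y) ≤ dist x y := fun x y => by
    rw [← map_sub, ← hi.dist_eq, dist_eq_norm]
    simpa using (Real.le_norm_self _).trans (g.le_of_opNorm_le hg (i x - i y))
  have hgS : ∀ x ∈ m.1.support, g (i x) = f x + (g (i u) - M) := fun x hx => by
    obtain ⟨h₁, h₂⟩ := hS x hx
    have h₃ := hg' u x
    have h₄ := hg' x v
    rw [map_sub] at hguv
    simp only [RCLike.ofReal_real_eq_id, id] at hguv
    linarith
  calc ‖m‖ = Molecule.lift f m := by
        rw [← LipschitzFree.apply_coe, hφm, UniformSpace.Completion.norm_coe]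
        rfl
    _ = Molecule.lift (fun x => g (i x)) m := (Molecule.lift_eq_of_eqOn_add_const _ hgS).symm
    _ = g (Molecule.lift i m) := by simp [Molecule.lift_apply]
    _ ≤ ‖g (Molecule.lift i m)‖ := Real.le_norm_self _
    _ ≤ 1 * ‖Molecule.lift i m‖ := g.le_of_opNorm_le hg _
    _ = ‖Molecule.lift i m‖ := one_mul _

theorem norm_lift [CompleteSpace B] (hU : IsUrysohn U) {i : U → B} (hi : Isometry i)
    (z : LipschitzFree U) : ‖LipschitzFree.lift i z‖ = ‖z‖ := by
  induction z using UniformSpace.Completion.induction_on with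
  | hp => exact isClosed_eq (by fun_prop) (by fun_prop)
  | ih m =>
    rw [LipschitzFree.lift_coe hi.lipschitz, hU.norm_lift_molecule hi,
      UniformSpace.Completion.norm_coe]

/-- The linearization of an isometric embedding of Urysohn's space is onto the closed linear span of
the image: its range is complete, hence closed. -/
theorem exists_linearIsometryEquiv [CompleteSpace B] (hU : IsUrysohn U) {i : U → B} {e : U}
    (hi : Isometry i) (he : i e = 0) :
    ∃ T : LipschitzFree U ≃ₗᵢ[ℝ] closedSpan i,
      ∀ x : U, (T (LipschitzFree.delta e x) : B) = i x := by
  let L : LipschitzFree U →ₗᵢ[ℝ] B := ⟨LipschitzFree.lift i, hU.norm_lift hi⟩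
  have hL : ∀ x, L (LipschitzFree.delta e x) = i x := fun x => by
    change LipschitzFree.lift i _ = _
    rw [LipschitzFree.lift_delta hi.lipschitz, he, sub_zero]
  have hrange : LinearMap.range L.toLinearMap = closedSpan i := by
    refine le_antisymm ?_ (Submodule.topologicalClosure_minimal _ ?_ ?_)
    · rw [LinearMap.range_eq_map, Submodule.map_le_iff_le_comap,
        ← LipschitzFree.closedSpan_delta e]
      refine Submodule.topologicalClosure_minimal _ ?_
        ((Submodule.isClosed_topologicalClosure _).preimage L.continuous)
      rw [Submodule.span_le]
      rintro _ ⟨x, rfl⟩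
      change L _ ∈ closedSpan i
      rw [hL]
      exact Submodule.le_topologicalClosure _ (Submodule.subset_span ⟨x, rfl⟩)
    · rw [Submodule.span_le]
      rintro _ ⟨x, rfl⟩
      exact ⟨_, hL x⟩
    · exact L.isometry.isClosedEmbedding.isClosed_range
  exact ⟨L.equivRange.trans (LinearIsometryEquiv.ofEq _ _ hrange), hL⟩

end IsUrysohn

/-! ### Linearization of nonlinear embeddings by averaging -/

section Smoothing

open Filter Topology

variable {E Z : Type*} [NormedAddCommGroup E] [NormedAddCommGroup Z] {g : E → Z}

theorem LipschitzWith.norm_sub_le_of_one (hg : LipschitzWith 1 g) (x y : E) :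
    ‖g x - g y‖ ≤ ‖x - y‖ := by
  simpa using hg.norm_sub_le x y

variable [NormedSpace ℝ E]

/-- The mixed second differences of `ψ`, with one increment along `x`, are `O(|s| * ‖z‖)`. This is
a derivative-free way to say that `ψ` has a Lipschitz derivative in the direction `x`; it passes to
averages of translates and to pointwise limits. -/
def BoundedMixedDifference (ψ : E → Z) (x : E) (C : ℝ) : Prop :=
  ∀ (y z : E) (s : ℝ), ‖ψ (y + s • x + z) - ψ (y + s • x) - (ψ (y + z) - ψ y)‖ ≤ C * |s| * ‖z‖

theorem BoundedMixedDifference.of_smul {x : E} {c C : ℝ} (hc : c ≠ 0)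
    (h : BoundedMixedDifference g (c • x) C) : BoundedMixedDifference g x (C * |c⁻¹|) := by
  intro y z s
  have := h y z (s * c⁻¹)
  rw [smul_smul, mul_assoc, inv_mul_cancel₀ hc, mul_one, abs_mul] at this
  linarith

theorem BoundedMixedDifference.of_tendsto {G : ℕ → E → Z} {x : E} {C : ℝ}
    (hG : ∀ y, Tendsto (fun n => G n y) atTop (𝓝 (g y)))
    (h : ∀ᶠ n in atTop, BoundedMixedDifference (G n) x C) : BoundedMixedDifference g x C :=
  fun y z s => le_of_tendsto
    (((hG (y + s • x + z)).sub (hG (y + s • x))).sub ((hG (y + z)).sub (hG y))).norm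
    (h.mono fun _ hn => hn y z s)

theorem intervalIntegrable_comp_segment (hg : LipschitzWith 1 g) (v x : E) (a b : ℝ) :
    IntervalIntegrable (fun t : ℝ => g (x + t • v)) MeasureTheory.volume a b :=
  (hg.continuous.comp (by fun_prop)).intervalIntegrable _ _

variable [NormedSpace ℝ Z]

/-- The average of `g` over the segments `[x, x + v]`. -/
noncomputable def segmentAverage (v : E) (g : E → Z) (x : E) : Z :=
  ∫ t in (0 : ℝ)..1, g (x + t • v)

theorem segmentAverage_sub (hg : LipschitzWith 1 g) (v x y : E) :
    segmentAverage v g x - segmentAverage v g y =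
      ∫ t in (0 : ℝ)..1, (g (x + t • v) - g (y + t • v)) :=
  (intervalIntegral.integral_sub (intervalIntegrable_comp_segment hg v x _ _)
    (intervalIntegrable_comp_segment hg v y _ _)).symm

theorem norm_integral_zero_one_le {C : ℝ} {f : ℝ → Z} (h : ∀ t ∈ Icc (0 : ℝ) 1, ‖f t‖ ≤ C) :
    ‖∫ t in (0 : ℝ)..1, f t‖ ≤ C := by
  have := intervalIntegral.norm_integral_le_of_norm_le_const (f := f) (a := 0) (b := 1) (C := C)
    fun t ht => h t (by rw [uIoc_of_le zero_le_one] at ht; exact Ioc_subset_Icc_self ht)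
  simpa using this

theorem lipschitzWith_segmentAverage (hg : LipschitzWith 1 g) (v : E) :
    LipschitzWith 1 (segmentAverage v g) :=
  LipschitzWith.of_dist_le_mul fun x y => by
    rw [dist_eq_norm, dist_eq_norm, segmentAverage_sub hg, NNReal.coe_one, one_mul]
    refine norm_integral_zero_one_le fun t _ => ?_
    simpa using hg.norm_sub_le_of_one (x + t • v) (y + t • v)

theorem norm_segmentAverage_sub_self_le [CompleteSpace Z] (hg : LipschitzWith 1 g) (v x : E) :
    ‖segmentAverage v g x - g x‖ ≤ ‖v‖ := by
  have h : g x = ∫ _ in (0 : ℝ)..1, g x := by simp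
  rw [h, segmentAverage, ← intervalIntegral.integral_sub
    (intervalIntegrable_comp_segment hg v x _ _) (by simp)]
  refine norm_integral_zero_one_le fun t ht => ?_
  refine (hg.norm_sub_le_of_one _ _).trans ?_
  rw [add_sub_cancel_left, norm_smul, Real.norm_of_nonneg ht.1]
  exact mul_le_of_le_one_left (norm_nonneg _) ht.2

theorem apply_segmentAverage_sub [CompleteSpace Z] (hg : LipschitzWith 1 g) (v : E)
    {l : StrongDual ℝ Z} {f : StrongDual ℝ E} (h : ∀ y z, l (g y - g z) = f (y - z)) (y z : E) :
    l (segmentAverage v g y - segmentAverage v g z) = f (y - z) := by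
  rw [segmentAverage_sub hg, ← ContinuousLinearMap.intervalIntegral_comp_comm]
  · simp [h]
  · exact (intervalIntegrable_comp_segment hg v y _ _).sub
      (intervalIntegrable_comp_segment hg v z _ _)

theorem BoundedMixedDifference.segmentAverage {x : E} {C : ℝ} (h : BoundedMixedDifference g x C)
    (hg : LipschitzWith 1 g) (v : E) : BoundedMixedDifference (segmentAverage v g) x C := by
  intro y z s
  have hi := fun a b => (intervalIntegrable_comp_segment hg v a 0 1).sub
      (intervalIntegrable_comp_segment hg v b 0 1)
  rw [segmentAverage_sub hg, segmentAverage_sub hg,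
    ← intervalIntegral.integral_sub (hi _ _) (hi _ _)]
  refine norm_integral_zero_one_le fun t _ => ?_
  have e₁ : y + s • x + z + t • v = y + t • v + s • x + z := by abel
  have e₂ : y + s • x + t • v = y + t • v + s • x := by abel
  have e₃ : y + z + t • v = y + t • v + z := by abel
  rw [e₁, e₂, e₃]
  exact h _ _ _

/-- Averaging along `v` makes a Lipschitz map differentiable in the direction `v`: translating
along `v` only changes the integral near the ends of the segment. -/
theorem boundedMixedDifference_segmentAverage (hg : LipschitzWith 1 g) (v : E) :
    BoundedMixedDifference (segmentAverage v g) v 2 := by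
  intro y z s
  set k : ℝ → Z := fun t => g (y + z + t • v) - g (y + t • v) with hk
  have hki : ∀ a b, IntervalIntegrable k MeasureTheory.volume a b := fun a b =>
    (intervalIntegrable_comp_segment hg v _ a b).sub (intervalIntegrable_comp_segment hg v _ a b)
  have hkn : ∀ a b, ‖∫ t in a..b, k t‖ ≤ ‖z‖ * |b - a| := fun a b =>
    intervalIntegral.norm_integral_le_of_norm_le_const fun t _ => by
      refine (hg.norm_sub_le_of_one _ _).trans_eq ?_
      congr 1
      abel
  have h₁ : segmentAverage v g (y + s • v + z) - segmentAverage v g (y + s • v) =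
      ∫ t in s..s + 1, k t := by
    rw [segmentAverage_sub hg]
    have := intervalIntegral.integral_comp_add_left (a := 0) (b := 1) k s
    rw [add_zero] at this
    rw [← this]
    congr 1
    ext t
    simp only [hk, add_smul]
    congr 2 <;> abel
  have h₂ : segmentAverage v g (y + z) - segmentAverage v g y = ∫ t in (0 : ℝ)..1, k t :=
    segmentAverage_sub hg _ _ _
  rw [h₁, h₂, intervalIntegral.integral_interval_sub_interval_comm' (hki _ _) (hki _ _) (hki _ _)]
  refine (norm_sub_le _ _).trans ?_
  refine (add_le_add (hkn _ _) (hkn _ _)).trans_eq ?_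
  rw [add_sub_cancel_right, sub_zero]
  ring

/-- Successive averages of `j` over the segments `[x, x + v 0]`, `[x, x + v 1]`, …: the `n`-th one is
the mean of `j (x + t₀ • v 0 + ⋯ + tₙ₋₁ • v (n - 1))` over the unit cube. -/
noncomputable def iteratedAverage (v : ℕ → E) (j : E → Z) : ℕ → E → Z
  | 0 => j
  | n + 1 => segmentAverage (v n) (iteratedAverage v j n)

theorem lipschitzWith_iteratedAverage (v : ℕ → E) {j : E → Z} (hj : LipschitzWith 1 j) (n : ℕ) :
    LipschitzWith 1 (iteratedAverage v j n) := by
  induction n with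
  | zero => exact hj
  | succ n ih => exact lipschitzWith_segmentAverage ih _

/-- A `1`-Lipschitz map on a separable space can be smoothed in a dense set of directions, by an
average over a Hilbert cube, without changing the functionals that it pulls back to linear ones. -/
theorem exists_smoothing [CompleteSpace Z] [TopologicalSpace.SeparableSpace E] {j : E → Z}
    (hj : LipschitzWith 1 j) :
    ∃ ψ : E → Z, LipschitzWith 1 ψ ∧ Dense {x | ∃ C, BoundedMixedDifference ψ x C} ∧
      ∀ (l : StrongDual ℝ Z) (f : StrongDual ℝ E), (∀ y z, l (j y - j z) = f (y - z)) →
        ∀ y z, l (ψ y - ψ z) = f (y - z) := by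
  set d := TopologicalSpace.denseSeq E
  set c : ℕ → ℝ := fun n => (1 / 2) ^ n / (1 + ‖d n‖)
  have hc : ∀ n, 0 < c n := fun n => by positivity
  set v : ℕ → E := fun n => c n • d n
  have hv : ∀ n, ‖v n‖ ≤ (1 / 2) ^ n := fun n => by
    rw [norm_smul, Real.norm_of_nonneg (hc n).le, div_mul_eq_mul_div,
      div_le_iff₀ (by positivity)]
    gcongr
    linarith
  set G := iteratedAverage v j
  have hGl : ∀ n, LipschitzWith 1 (G n) := lipschitzWith_iteratedAverage v hj
  have hG : ∀ x, ∃ z, Tendsto (fun n => G n x) atTop (𝓝 z) := fun x =>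
    cauchySeq_tendsto_of_complete <|
      cauchySeq_of_le_geometric (1 / 2) 1 (by norm_num) fun n => by
        rw [one_mul, dist_comm, dist_eq_norm]
        exact (norm_segmentAverage_sub_self_le (hGl n) _ x).trans (hv n)
  choose ψ hψ using hG
  refine ⟨ψ, LipschitzWith.of_dist_le_mul fun x y => ?_, ?_, fun l f h y z => ?_⟩
  · exact le_of_tendsto ((hψ x).dist (hψ y)) (.of_forall fun n => (hGl n).dist_le_mul x y)
  · refine (TopologicalSpace.denseRange_denseSeq E).mono ?_
    rintro _ ⟨n, rfl⟩
    refine ⟨_, .of_smul (hc n).ne' (.of_tendsto (C := 2) hψ ?_)⟩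
    filter_upwards [eventually_ge_atTop (n + 1)] with N hN
    induction N, hN using Nat.le_induction with
    | base => exact boundedMixedDifference_segmentAverage (hGl n) _
    | succ N _ ih => exact ih.segmentAverage (hGl N) _
  · have h' : ∀ n, l (G n y - G n z) = f (y - z) := fun n => by
      induction n generalizing y z with
      | zero => exact h y z
      | succ n ih => exact apply_segmentAverage_sub (hGl n) _ ih y z
    refine tendsto_nhds_unique ((l.continuous.tendsto _).comp ((hψ y).sub (hψ z))) ?_
    simp only [Function.comp_def, h']
    exact tendsto_const_nhds

/-- The difference quotients at `0` along the steps `2⁻ᵏ`. -/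
noncomputable def dyadicQuotient (ψ : E → Z) (k : ℕ) (x : E) : Z :=
  (2 : ℝ) ^ k • (ψ (((2 : ℝ) ^ k)⁻¹ • x) - ψ 0)

theorem lipschitzWith_dyadicQuotient {ψ : E → Z} (hψ : LipschitzWith 1 ψ) (k : ℕ) :
    LipschitzWith 1 (dyadicQuotient ψ k) :=
  LipschitzWith.of_dist_le_mul fun x y => by
    rw [NNReal.coe_one, one_mul, dist_eq_norm, dist_eq_norm, dyadicQuotient, dyadicQuotient,
      ← smul_sub, sub_sub_sub_cancel_right, norm_smul, Real.norm_of_nonneg (by positivity)]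
    have h := hψ.norm_sub_le_of_one (((2 : ℝ) ^ k)⁻¹ • x) (((2 : ℝ) ^ k)⁻¹ • y)
    rw [← smul_sub, norm_smul, Real.norm_of_nonneg (by positivity)] at h
    rwa [← le_inv_mul_iff₀ (by positivity)]

theorem BoundedMixedDifference.norm_dyadicQuotient_add_sub_le {ψ : E → Z} {x : E} {C : ℝ}
    (h : BoundedMixedDifference ψ x C) (k : ℕ) (y : E) :
    ‖dyadicQuotient ψ k (x + y) - dyadicQuotient ψ k x - dyadicQuotient ψ k y‖ ≤
      C * ‖y‖ * (1 / 2) ^ k := by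
  have h2 : (0 : ℝ) < 2 ^ k := by positivity
  have := h 0 (((2 : ℝ) ^ k)⁻¹ • y) ((2 : ℝ) ^ k)⁻¹
  simp only [zero_add] at this
  simp only [dyadicQuotient, ← smul_sub, smul_add]
  rw [norm_smul, Real.norm_of_nonneg h2.le, sub_sub_sub_cancel_right, ← le_inv_mul_iff₀ h2]
  refine this.trans_eq ?_
  rw [norm_smul, Real.norm_of_nonneg (by positivity), abs_of_pos (by positivity), one_div, inv_pow]
  ring

/-- Doubling: the mixed difference with both increments `2⁻ᵏ⁻¹ • x` compares consecutive
quotients. -/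
theorem BoundedMixedDifference.dist_dyadicQuotient_succ_le {ψ : E → Z} {x : E} {C : ℝ}
    (h : BoundedMixedDifference ψ x C) (k : ℕ) :
    dist (dyadicQuotient ψ k x) (dyadicQuotient ψ (k + 1) x) ≤ C * ‖x‖ / 4 * (1 / 2) ^ k := by
  have h2 : (0 : ℝ) < 2 ^ k := by positivity
  set a : ℝ := ((2 : ℝ) ^ (k + 1))⁻¹
  have ha : (0 : ℝ) < a := by positivity
  have haa : ((2 : ℝ) ^ k)⁻¹ = a + a := by simp only [a, pow_succ]; field_simp; norm_num
  have := h 0 (a • x) a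
  simp only [zero_add] at this
  have e : dyadicQuotient ψ k x - dyadicQuotient ψ (k + 1) x =
      (2 : ℝ) ^ k • (ψ (a • x + a • x) - ψ (a • x) - (ψ (a • x) - ψ 0)) := by
    rw [dyadicQuotient, dyadicQuotient, haa, add_smul, pow_succ, mul_smul, two_smul, ← smul_sub]
    congr 1
    abel
  rw [dist_eq_norm, e, norm_smul, Real.norm_of_nonneg h2.le, ← le_inv_mul_iff₀ h2]
  refine this.trans_eq ?_
  rw [norm_smul, Real.norm_of_nonneg ha.le, abs_of_pos ha, haa, one_div, inv_pow, haa]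
  ring

/-- A Lipschitz map that is smooth in a dense set of directions has a linear derivative at `0`,
along dyadic steps. Additivity of the limit is the vanishing of mixed second differences. -/
theorem exists_tendsto_dyadicQuotient [CompleteSpace Z] {ψ : E → Z} (hψ : LipschitzWith 1 ψ)
    (hd : Dense {x | ∃ C, BoundedMixedDifference ψ x C}) :
    ∃ T : E →L[ℝ] Z, ∀ x, Tendsto (fun k => dyadicQuotient ψ k x) atTop (𝓝 (T x)) := by
  have hl := lipschitzWith_dyadicQuotient hψ
  have hcauchy : ∀ x, CauchySeq fun k => dyadicQuotient ψ k x := fun x => by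
    rw [Metric.cauchySeq_iff']
    intro ε hε
    obtain ⟨y, ⟨C, hC⟩, hxy⟩ := hd.exists_dist_lt x (ε := ε / 3) (by positivity)
    have hy := cauchySeq_of_le_geometric (1 / 2) _ (by norm_num) hC.dist_dyadicQuotient_succ_le
    obtain ⟨N, hN⟩ := Metric.cauchySeq_iff'.1 hy (ε / 3) (by positivity)
    refine ⟨N, fun n hn => ?_⟩
    have h₁ := (hl n).dist_le_mul x y
    have h₂ := (hl N).dist_le_mul y x
    rw [dist_comm y x] at h₂
    rw [NNReal.coe_one, one_mul] at h₁ h₂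
    linarith [hN n hn, dist_triangle4 (dyadicQuotient ψ n x) (dyadicQuotient ψ n y)
      (dyadicQuotient ψ N y) (dyadicQuotient ψ N x)]
  choose T hT using fun x => cauchySeq_tendsto_of_complete (hcauchy x)
  have hTl : LipschitzWith 1 T := LipschitzWith.of_dist_le_mul fun x y =>
    le_of_tendsto ((hT x).dist (hT y)) (.of_forall fun n => (hl n).dist_le_mul x y)
  have hTc := hTl.continuous
  have hadd : ∀ x y, T (x + y) = T x + T y := fun x y => by
    refine hd.induction (P := fun x => T (x + y) = T x + T y) ?_
      (isClosed_eq (by fun_prop) (by fun_prop)) x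
    rintro x ⟨C, hC⟩
    have h₁ := ((hT (x + y)).sub (hT x)).sub (hT y)
    have h₂ : Tendsto (fun k : ℕ => C * ‖y‖ * (1 / 2 : ℝ) ^ k) atTop (𝓝 0) := by
      simpa using (tendsto_pow_atTop_nhds_zero_of_lt_one (r := (1 / 2 : ℝ)) (by norm_num)
        (by norm_num)).const_mul (C * ‖y‖)
    have h₃ := tendsto_nhds_unique h₁
      (squeeze_zero_norm (fun k => hC.norm_dyadicQuotient_add_sub_le k y) h₂)
    rw [sub_sub, sub_eq_zero] at h₃
    exact h₃
  exact ⟨(AddMonoidHom.mk' T hadd).toRealLinearMap hTc, hT⟩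

/-- A separable space `E` embeds linearly and isometrically in `Z` as soon as some `1`-Lipschitz
map `j : E → Z` has the property that every functional of norm at most `1` on `E` is pulled back,
up to a constant, from a functional of norm at most `1` on `Z`. The embedding is the derivative of a
smoothing of `j`. -/
theorem nonempty_linearIsometry_of_lipschitzWith [CompleteSpace Z]
    [TopologicalSpace.SeparableSpace E] {j : E → Z} (hj : LipschitzWith 1 j)
    (hdual : ∀ f : StrongDual ℝ E, ‖f‖ ≤ 1 →
      ∃ l : StrongDual ℝ Z, ‖l‖ ≤ 1 ∧ ∀ y z, l (j y - j z) = f (y - z)) :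
    Nonempty (E →ₗᵢ[ℝ] Z) := by
  obtain ⟨ψ, hψ, hd, hψf⟩ := exists_smoothing hj
  obtain ⟨T, hT⟩ := exists_tendsto_dyadicQuotient hψ hd
  refine ⟨⟨T, fun x => le_antisymm ?_ ?_⟩⟩
  · refine le_of_tendsto (hT x).norm (.of_forall fun k => ?_)
    have h := (lipschitzWith_dyadicQuotient hψ k).norm_sub_le_of_one x 0
    have h0 : dyadicQuotient ψ k 0 = 0 := by simp [dyadicQuotient]
    rwa [h0, sub_zero, sub_zero] at h
  · obtain ⟨f, hf, hfx⟩ := exists_dual_vector'' ℝ x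
    obtain ⟨l, hl, hlf⟩ := hdual f hf
    have h : ∀ k, l (dyadicQuotient ψ k x) = ‖x‖ := fun k => by
      rw [dyadicQuotient, map_smul, hψf l f hlf, sub_zero, map_smul, smul_smul,
        mul_inv_cancel₀ (by positivity), one_smul, hfx]
      rfl
    have hlT : l (T x) = ‖x‖ := by
      refine tendsto_nhds_unique ((l.continuous.tendsto _).comp (hT x)) ?_
      simp only [Function.comp_def, h]
      exact tendsto_const_nhds
    calc ‖x‖ = l (T x) := hlT.symm
      _ ≤ ‖l (T x)‖ := Real.le_norm_self _
      _ ≤ 1 * ‖T x‖ := l.le_of_opNorm_le hl _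
      _ = ‖T x‖ := one_mul _

end Smoothing

/-! ### Universality for separable Banach spaces -/

namespace IsUrysohn

variable {U : Type u} [MetricSpace U]

/-- Universality of Urysohn's space in every universe, by way of a copy in `ℓ^∞(ℕ)`. -/
theorem exists_isometry (hU : IsUrysohn U) (P : Type w) [MetricSpace P] [CompleteSpace P]
    [TopologicalSpace.SeparableSpace P] : ∃ f : P → U, Isometry f := by
  have e := (kuratowskiEmbedding.isometry P).isometryEquivOnRange
  have := e.symm.completeSpace
  have := (TopologicalSpace.isSeparable_range
    (kuratowskiEmbedding.isometry P).continuous).separableSpace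
  obtain ⟨f, hf⟩ := hU.universal (range (kuratowskiEmbedding P))
  exact ⟨f ∘ e, hf.comp e.isometry⟩

theorem isUniversalSeparableBanach (hU : IsUrysohn U) :
    IsUniversalSeparableBanach.{w} (LipschitzFree U) := by
  have := hU.separable
  obtain ⟨k₀, -⟩ := hU.universal Unit
  set e : U := k₀ ()
  refine ⟨inferInstance, LipschitzFree.separableSpace e, fun E _ _ _ _ => ?_⟩
  obtain ⟨k, hk⟩ := hU.exists_isometry E
  refine nonempty_linearIsometry_of_lipschitzWith (j := LipschitzFree.delta e ∘ k)
    ((LipschitzFree.isometry_delta e).comp hk).lipschitz fun f hf => ?_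
  -- Extend `f`, as a `1`-Lipschitz function on the copy of `E` in `U`, to all of `U`.
  have hfl : LipschitzOnWith 1 (f ∘ Function.invFun k) (range k) := by
    refine LipschitzOnWith.of_dist_le_mul ?_
    rintro _ ⟨x, rfl⟩ _ ⟨y, rfl⟩
    simp only [Function.comp_apply, Function.leftInverse_invFun hk.injective _, hk.dist_eq]
    rw [NNReal.coe_one, dist_eq_norm, dist_eq_norm, ← map_sub]
    exact f.le_of_opNorm_le hf _
  obtain ⟨F, hF, hFf⟩ := hfl.extend_real
  have hFk : ∀ x, F (k x) = f x := fun x => by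
    rw [← hFf ⟨x, rfl⟩, Function.comp_apply, Function.leftInverse_invFun hk.injective]
  refine ⟨LipschitzFree.lift F, LipschitzFree.norm_lift_le hF, fun y z => ?_⟩
  simp only [Function.comp_apply, map_sub, LipschitzFree.lift_delta hF, hFk]
  ring

end IsUrysohn

theorem IsUniversalSeparableBanach.of_linearIsometryEquiv {V W : Type*} [NormedAddCommGroup V]
    [NormedSpace ℝ V] [NormedAddCommGroup W] [NormedSpace ℝ W]
    (h : IsUniversalSeparableBanach.{w} V) (T : V ≃ₗᵢ[ℝ] W) : IsUniversalSeparableBanach.{w} W := by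
  obtain ⟨hc, hs, hV⟩ := h
  refine ⟨T.symm.toIsometryEquiv.completeSpace,
    T.surjective.denseRange.separableSpace T.continuous, fun E _ _ _ _ => ?_⟩
  obtain ⟨L⟩ := hV E
  exact ⟨T.toLinearIsometry.comp L⟩

theorem mainTheorem3 (U : Type u) [MetricSpace U] (hU : IsUrysohn U) :
    -- the canonical maps of `U` into `F(U)` are isometric, with closed linear span `F(U)`
    (∀ e : U, Isometry (LipschitzFree.delta e) ∧ LipschitzFree.delta e e = 0 ∧
      closedSpan (LipschitzFree.delta e) = ⊤) ∧
    -- for any isometric embedding of `U` in a Banach space sending some point `e` to `0`, the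
    -- closed linear span is `F(U)`, canonically; so it is uniquely determined
    (∀ (B : Type v) [NormedAddCommGroup B] [NormedSpace ℝ B] [CompleteSpace B] (i : U → B) (e : U),
      Isometry i → i e = 0 →
        ∃ T : LipschitzFree U ≃ₗᵢ[ℝ] closedSpan i,
          ∀ x : U, (T (LipschitzFree.delta e x) : B) = i x) ∧
    -- this closed linear span is universal for separable Banach spaces up to linear isometry
    IsUniversalSeparableBanach.{w} (LipschitzFree U) ∧
    (∀ (B : Type v) [NormedAddCommGroup B] [NormedSpace ℝ B] [CompleteSpace B] (i : U → B) (e : U),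
      Isometry i → i e = 0 → IsUniversalSeparableBanach.{w} (closedSpan i)) := by
  refine ⟨fun e => ⟨LipschitzFree.isometry_delta e, LipschitzFree.delta_self e,
    LipschitzFree.closedSpan_delta e⟩, fun B _ _ _ i e hi he => hU.exists_linearIsometryEquiv hi he,
    hU.isUniversalSeparableBanach, fun B _ _ _ i e hi he => ?_⟩
  obtain ⟨T, -⟩ := hU.exists_linearIsometryEquiv hi he
  exact hU.isUniversalSeparableBanach.of_linearIsometryEquiv T
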